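/- **Definitions.** A *standard measure space* is a measure space $(X,\mu)$ whose σ-algebra is the Borel σ-algebra of some completely metrizable, separable and locally compact topology on $X$ with respect to which $\mu$ is a (positive) Radon measure. Let $(X,\mu)$ and $(Y,\nu)$ be standard measure spaces. A set $E\subseteq X\times Y$ is *marginally null* if $E\subseteq (X_0\times Y)\cup(X\times Y_0)$ for some $X_0\subseteq X$, $Y_0\subseteq Y$ with $\mu(X_0)=0$ and $\nu(Y_0)=0$; two sets are *marginally equivalent* if their symmetric difference is marginally null; $E$ is *$\omega$-open* if it is marginally equivalent to a countable union of rectangles $A\times B$ with $A\subseteq X$, $B\subseteq Y$ measurable; and $E$ is *$\omega$-closed* if its complement is $\omega$-open. A complex measure $\sigma$ of finite total variation on the product σ-algebra of $Y\times X$ is an *Arveson measure* if there is a constant $c>0$ such that the marginals of its variation $|\sigma|$ satisfy $|\sigma|_Y\le c\,\nu$ and $|\sigma|_X\le c\,\mu$. Such a $\sigma$ defines a unique bounded operator $T_\sigma:L^2(X,\mu)\to L^2(Y,\nu)$ (the *pseudo-integral operator* of $\sigma$) with $$(T_\sigma f,g)=\int_{Y\times X} f(x)\,\overline{g(y)}\,d\sigma(y,x)\qquad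 (f\in L^2(X,\mu),\ g\in L^2(Y,\nu)).$$ For $\kappa\subseteq X\times Y$ put $\hat\kappa=\{(y,x):(x,y)\in\kappa\}$; if $\kappa$ is $\omega$-closed, $\sigma$ is *supported on* $\hat\kappa$ if the complement of $\hat\kappa$ is $|\sigma|$-null. An $\omega$-closed set $\kappa\subseteq X\times Y$ is an *operator $M_0$-set* if there is a non-zero Arveson measure $\sigma$ on $Y\times X$, supported on $\hat\kappa$, such that $T_\sigma$ is compact. **Theorem.** For $i=1,2$ let $(X_i,\mu_i)$ and $(Y_i,\nu_i)$ be standard measure spaces and let $\kappa_i\subseteq X_i\times Y_i$ be $\omega$-closed sets. Let $$\rho:(X_1\times Y_1)\times(X_2\times Y_2)\to(X_1\times X_2)\times(Y_1\times Y_2),\qquad ((x_1,y_1),(x_2,y_2))\mapsto((x_1,x_2),(y_1,y_2)),$$ and equip $X_1\times X_2$ and $Y_1\times Y_2$ with the product measures $\mu_1\times\mu_2$ and $\nu_1\times\nu_2$. Then $\rho(\kappa_1\times\kappa_2)$ is an operator $M_0$-set if and only if both $\kappa_1$ and $\kappa_2$ are operator $M_0$-sets. -/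

import Mathlib

open MeasureTheory Set
open scoped NNReal ENNReal InnerProductSpace symmDiff

noncomputable section

namespace OperatorM0

/-- `(X, μ)` is a standard measure space: the σ-algebra is the Borel σ-algebra of some completely
metrizable, separable, locally compact topology, with respect to which `μ` is a Radon measure
(possibly infinite, but finite on compact sets, and regular). -/
def IsStandardMeasureSpace {X : Type*} [MeasurableSpace X] (μ : Measure X) : Prop :=
  ∃ _ : TopologicalSpace X, PolishSpace X ∧ LocallyCompactSpace X ∧ BorelSpace X ∧ μ.Regular

section Omega

variable {X Y : Type*} [MeasurableSpace X] [MeasurableSpace Y] (μ : Measure X) (ν : Measure Y)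

/-- `E ⊆ (X₀ × Y) ∪ (X × Y₀)` with `μ X₀ = 0` and `ν Y₀ = 0`. -/
def MarginallyNull (E : Set (X × Y)) : Prop :=
  ∃ (X₀ : Set X) (Y₀ : Set Y), μ X₀ = 0 ∧ ν Y₀ = 0 ∧ E ⊆ X₀ ×ˢ univ ∪ univ ×ˢ Y₀

/-- Marginal equivalence `E ∼ F`. -/
def MarginallyEquivalent (E F : Set (X × Y)) : Prop :=
  MarginallyNull μ ν (E ∆ F)

/-- Marginally equivalent to a countable union of measurable rectangles. -/
def IsOmegaOpen (E : Set (X × Y)) : Prop :=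
  ∃ (A : ℕ → Set X) (B : ℕ → Set Y), (∀ n, MeasurableSet (A n)) ∧ (∀ n, MeasurableSet (B n)) ∧
    MarginallyEquivalent μ ν E (⋃ n, A n ×ˢ B n)

/-- The complement is ω-open. -/
def IsOmegaClosed (E : Set (X × Y)) : Prop :=
  IsOmegaOpen μ ν Eᶜ

/-- Arveson measures on `X × Y`: complex measures of finite total variation such that both
marginals of the variation `|σ|` are dominated by constant multiples of `μ` and `ν`. -/
def IsArvesonMeasure (σ : ComplexMeasure (X × Y)) : Prop :=
  IsFiniteMeasure σ.variation ∧
    ∃ c : ℝ≥0, 0 < c ∧ σ.variation.map Prod.fst ≤ c • μ ∧ σ.variation.map Prod.snd ≤ c • ν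

/-- The set `𝔸(F)` of the Arveson measures supported on the ω-closed set `F`, that is, those for
which `F` has `|σ|`-null complement. (The set `Fᶜ` need not be measurable; `σ.variation Fᶜ` is then
the outer measure. The support of `σ` is, up to marginal equivalence, the smallest ω-closed set
with `|σ|`-null complement, and marginally null sets are `|σ|`-null.) -/
def arvesonMeasures (F : Set (X × Y)) : Set (ComplexMeasure (X × Y)) :=
  {σ | IsArvesonMeasure μ ν σ ∧ σ.variation Fᶜ = 0}

/-- `T = T_σ` is the pseudo-integral operator `L²(X, μ) → L²(Y, ν)` of the measure `σ` on `Y × X`: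
`(T f, g) = ∫ f(x) * conj (g(y)) dσ(y, x)` for all `f ∈ L²(X, μ)` and `g ∈ L²(Y, ν)`.
(Mathlib's inner product is conjugate linear in its first argument.) -/
def IsPseudoIntegral (σ : ComplexMeasure (Y × X)) (T : Lp ℂ 2 μ →L[ℂ] Lp ℂ 2 ν) : Prop :=
  ∀ (f : Lp ℂ 2 μ) (g : Lp ℂ 2 ν),
    ⟪g, T f⟫_ℂ =
      σ.integral (fun p : Y × X => f p.2 * starRingEnd ℂ (g p.1)) (ContinuousLinearMap.mul ℝ ℂ)

/-- The reflection `κ̂ = {(y, x) | (x, y) ∈ κ}`. -/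
def hat {X Y : Type*} (κ : Set (X × Y)) : Set (Y × X) :=
  {p | (p.2, p.1) ∈ κ}

/-- `κ` is ω-closed and there is a non-zero Arveson measure `σ ∈ 𝔸(κ̂)` whose pseudo-integral
operator `T_σ` is compact. -/
def IsOperatorM0Set (κ : Set (X × Y)) : Prop :=
  IsOmegaClosed μ ν κ ∧
    ∃ σ ∈ arvesonMeasures ν μ (hat κ), σ ≠ 0 ∧
      ∃ T : Lp ℂ 2 μ →L[ℂ] Lp ℂ 2 ν, IsPseudoIntegral μ ν σ T ∧ IsCompactOperator T

end Omega

/-- The map `((x₁, y₁), (x₂, y₂)) ↦ ((x₁, x₂), (y₁, y₂))`. -/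
def rho {X₁ X₂ Y₁ Y₂ : Type*} (p : (X₁ × Y₁) × (X₂ × Y₂)) : (X₁ × X₂) × (Y₁ × Y₂) :=
  ((p.1.1, p.2.1), (p.1.2, p.2.2))

end OperatorM0

end

/-! The two directions are a tensor product and a compression.

If `σ₁`, `σ₂` witness that `κ₁`, `κ₂` are operator `M₀`-sets, the product measure with its
coordinates rearranged (`rhoProd`) is a witness for the product. Its variation is dominated by the
product of the variations, which controls marginals and support, and it is non-zero because it
multiplies on rectangles. As the algebraic tensor product of the `L²` spaces sits isometrically and
densely in `L²` of the product, its operator is `T₁ ⊗ T₂`. This is compact: it is a norm limit of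
operators factoring through finite-dimensional spaces (`isCompactOperator_tensorExtend`).

Conversely, restrict a witness `σ` for the product to `(Y₁ × B) × (X₁ × A)`, with `A` and `B` of
finite measure, and push it forward to `Y₁ × X₁`. Finiteness of `A` and `B` keeps the marginals
bounded. The new operator is `W* T V` with `V f = f ⊗ 1_A` and `W g = g ⊗ 1_B`, hence compact. The
support passes to `κ₁` because, up to null fibres, its complement is a countable union of
rectangles. Some slice is non-zero because rectangles determine a complex measure. Swapping the
coordinates gives `κ₂`; the swap is itself a slice, so `isOperatorM0Set_of_sliceMeasure_ne_zero`
covers both steps. -/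

noncomputable section

namespace OperatorM0

/-! ### Tensor products of compact operators on Hilbert spaces -/

section HilbertTensor

open scoped TensorProduct
open TensorProduct

variable {H₁ H₂ H K₁ K₂ K : Type*}
  [NormedAddCommGroup H₁] [InnerProductSpace ℂ H₁] [NormedAddCommGroup H₂] [InnerProductSpace ℂ H₂]
  [NormedAddCommGroup H] [InnerProductSpace ℂ H]
  [NormedAddCommGroup K₁] [InnerProductSpace ℂ K₁] [NormedAddCommGroup K₂] [InnerProductSpace ℂ K₂]
  [NormedAddCommGroup K] [InnerProductSpace ℂ K] [CompleteSpace K]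

/-- A compact operator into an inner product space is approximated in norm by its compositions
with orthogonal projections onto finite-dimensional subspaces. -/
theorem exists_finiteDimensional_norm_sub_starProjection_comp_le {A : H₁ →L[ℂ] K₁}
    (hA : IsCompactOperator A) {ε : ℝ} (hε : 0 < ε) :
    ∃ (F : Submodule ℂ K₁) (_ : FiniteDimensional ℂ F),
      ‖A - F.starProjection ∘L A‖ ≤ ε := by
  obtain ⟨S, hS, hAS⟩ := hA.image_closedBall_subset_compact 1
  -- The span of a finite `ε`-net of the image of the unit ball works, since the orthogonal
  -- projection is at least as close to `A x` as any point of the net.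
  obtain ⟨t, ht, hcov⟩ := Metric.totallyBounded_iff.1 hS.totallyBounded ε hε
  have hfin : FiniteDimensional ℂ (Submodule.span ℂ t) := FiniteDimensional.span_of_finite ℂ ht
  refine ⟨Submodule.span ℂ t, hfin, ?_⟩
  refine ContinuousLinearMap.opNorm_le_of_unit_norm hε.le fun x hx => ?_
  have hx' : A x ∈ S := hAS ⟨x, by simp [hx], rfl⟩
  obtain ⟨y, hy, hxy⟩ := mem_iUnion₂.1 (hcov hx')
  have hmin : ‖A x - (Submodule.span ℂ t).starProjection (A x)‖ ≤ ‖A x - y‖ := by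
    rw [Submodule.starProjection_minimal]
    exact ciInf_le ⟨0, by rintro _ ⟨z, rfl⟩; positivity⟩
      (⟨y, Submodule.subset_span hy⟩ : Submodule.span ℂ t)
  simpa using hmin.trans (by rw [← dist_eq_norm]; exact (Metric.mem_ball.1 hxy).le)

/-- The operator `A ⊗ B` between Hilbert space completions of algebraic tensor products. -/
def tensorExtend (ι : H₁ ⊗[ℂ] H₂ →ₗᵢ[ℂ] H) (ι' : K₁ ⊗[ℂ] K₂ →ₗᵢ[ℂ] K)
    (A : H₁ →L[ℂ] K₁) (B : H₂ →L[ℂ] K₂) : H →L[ℂ] K :=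
  (ι'.toContinuousLinearMap ∘L mapL A B).extend ι.toContinuousLinearMap

variable {ι : H₁ ⊗[ℂ] H₂ →ₗᵢ[ℂ] H} {ι' : K₁ ⊗[ℂ] K₂ →ₗᵢ[ℂ] K}

theorem tensorExtend_apply (hι : DenseRange ι) (A : H₁ →L[ℂ] K₁) (B : H₂ →L[ℂ] K₂)
    (x : H₁ ⊗[ℂ] H₂) : tensorExtend ι ι' A B (ι x) = ι' (mapL A B x) :=
  ContinuousLinearMap.extend_eq (e := ι.toContinuousLinearMap) _ hι
    ι.isometry.isUniformInducing x

theorem tensorExtend_unique (hι : DenseRange ι) {A : H₁ →L[ℂ] K₁} {B : H₂ →L[ℂ] K₂}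
    {C : H →L[ℂ] K} (h : ∀ a b, C (ι (a ⊗ₜ b)) = ι' (A a ⊗ₜ B b)) :
    tensorExtend ι ι' A B = C := by
  refine ContinuousLinearMap.extend_unique (e := ι.toContinuousLinearMap) _ hι
    ι.isometry.isUniformInducing C ?_
  ext x
  induction x with
  | zero => simp
  | tmul a b => simpa using h a b
  | add x y hx hy => rw [map_add, map_add, hx, hy]

theorem norm_tensorExtend_le (hι : DenseRange ι) (A : H₁ →L[ℂ] K₁) (B : H₂ →L[ℂ] K₂) :
    ‖tensorExtend ι ι' A B‖ ≤ ‖A‖ * ‖B‖ := by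
  refine (ContinuousLinearMap.opNorm_extend_le (N := 1) (e := ι.toContinuousLinearMap) _ hι
    fun x => by simp).trans ?_
  rw [NNReal.coe_one, one_mul]
  refine le_trans ?_ (norm_mapL_le A B)
  refine ContinuousLinearMap.opNorm_le_bound _ (norm_nonneg (mapL A B)) fun x => ?_
  simpa only [ContinuousLinearMap.comp_apply, LinearIsometry.coe_toContinuousLinearMap,
    LinearIsometry.norm_map] using (mapL A B).le_opNorm x

theorem tensorExtend_sub_left (hι : DenseRange ι) (A A' : H₁ →L[ℂ] K₁) (B : H₂ →L[ℂ] K₂) :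
    tensorExtend ι ι' (A - A') B = tensorExtend ι ι' A B - tensorExtend ι ι' A' B :=
  tensorExtend_unique hι fun a b => by
    simp [tensorExtend_apply hι, TensorProduct.sub_tmul]

theorem tensorExtend_sub_right (hι : DenseRange ι) (A : H₁ →L[ℂ] K₁) (B B' : H₂ →L[ℂ] K₂) :
    tensorExtend ι ι' A (B - B') = tensorExtend ι ι' A B - tensorExtend ι ι' A B' :=
  tensorExtend_unique hι fun a b => by
    simp [tensorExtend_apply hι, TensorProduct.tmul_sub]

/-- The operator factors through `F ⊗ G`, which is finite-dimensional and hence locally compact. -/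
theorem isCompactOperator_tensorExtend_starProjection_comp (hι : DenseRange ι)
    (A : H₁ →L[ℂ] K₁) (B : H₂ →L[ℂ] K₂)
    (F : Submodule ℂ K₁) (G : Submodule ℂ K₂) [FiniteDimensional ℂ F] [FiniteDimensional ℂ G] :
    IsCompactOperator
      (tensorExtend ι ι' (F.starProjection ∘L A) (G.starProjection ∘L B)) := by
  have : ProperSpace (F ⊗[ℂ] G) := FiniteDimensional.proper ℂ _
  set C : H →L[ℂ] F ⊗[ℂ] G := tensorExtend ι LinearIsometry.id
    (F.orthogonalProjectionOnto ∘L A) (G.orthogonalProjectionOnto ∘L B) with hC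
  have key : tensorExtend ι ι' (F.starProjection ∘L A) (G.starProjection ∘L B) =
      (ι'.toContinuousLinearMap ∘L mapL F.subtypeL G.subtypeL) ∘L C :=
    tensorExtend_unique hι fun a b => by
      rw [ContinuousLinearMap.comp_apply, hC, tensorExtend_apply hι]
      rfl
  rw [key, ContinuousLinearMap.coe_comp]
  exact (isCompactOperator_of_locallyCompactSpace_dom C).clm_comp _

/-- The tensor product of compact operators is compact. -/
theorem isCompactOperator_tensorExtend (hι : DenseRange ι) {A : H₁ →L[ℂ] K₁} {B : H₂ →L[ℂ] K₂}
    (hA : IsCompactOperator A) (hB : IsCompactOperator B) :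
    IsCompactOperator (tensorExtend ι ι' A B) := by
  refine (isClosed_setOfPred_isCompactOperator (σ₁₂ := RingHom.id ℂ) (M₁ := H)
    (M₂ := K)).closure_subset (Metric.mem_closure_iff.2 fun ε hε => ?_)
  -- Two errors of size `ε / M`, weighted by `‖B‖` and `‖A‖`, add up to `ε / M * (M - 1) < ε`. The
  -- summand `1` gives both `M > 0` and the strict inequality.
  set M : ℝ := ‖A‖ + ‖B‖ + 1 with hM
  have hM0 : 0 < M := by positivity
  obtain ⟨F, hF, hAF⟩ :=
    exists_finiteDimensional_norm_sub_starProjection_comp_le hA (div_pos hε hM0)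
  obtain ⟨G, hG, hBG⟩ :=
    exists_finiteDimensional_norm_sub_starProjection_comp_le hB (div_pos hε hM0)
  refine ⟨_, isCompactOperator_tensorExtend_starProjection_comp (ι' := ι') hι A B F G, ?_⟩
  have hPA : ‖F.starProjection ∘L A‖ ≤ ‖A‖ := by
    refine (ContinuousLinearMap.opNorm_comp_le _ _).trans ?_
    exact mul_le_of_le_one_left (norm_nonneg _) F.starProjection_norm_le
  rw [dist_eq_norm]
  calc ‖tensorExtend ι ι' A B -
        tensorExtend ι ι' (F.starProjection ∘L A) (G.starProjection ∘L B)‖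
      = ‖tensorExtend ι ι' (A - F.starProjection ∘L A) B +
          tensorExtend ι ι' (F.starProjection ∘L A) (B - G.starProjection ∘L B)‖ := by
        rw [tensorExtend_sub_left hι, tensorExtend_sub_right hι, sub_add_sub_cancel]
    _ ≤ ε / M * ‖B‖ + ‖A‖ * (ε / M) := by
        refine (norm_add_le _ _).trans (add_le_add ?_ ?_)
        · exact (norm_tensorExtend_le hι _ _).trans (by gcongr)
        · exact (norm_tensorExtend_le hι _ _).trans (by gcongr)
    _ = ε / M * (M - 1) := by rw [hM]; ring
    _ < ε := by
        rw [mul_sub, div_mul_cancel₀ _ hM0.ne', mul_one]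
        exact sub_lt_self _ (div_pos hε hM0)

end HilbertTensor

/-! ### Composition operators on `L²` along maps with bounded image measure -/

section Pullback

variable {X Z : Type*} [MeasurableSpace X] [MeasurableSpace Z] {μ : Measure X} {m : Measure Z}
  {u : Z → X} {A : Set Z} {C : ℝ≥0}

theorem indicator_comp_ae_eq (hu : Measurable u) (hA : MeasurableSet A)
    (h : (m.restrict A).map u ≤ C • μ) {f g : X → ℂ} (hfg : f =ᵐ[μ] g) :
    A.indicator (f ∘ u) =ᵐ[m] A.indicator (g ∘ u) := by
  have hac : (m.restrict A).map u ≪ μ := Measure.absolutelyContinuous_of_le_smul h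
  have := ae_of_ae_map hu.aemeasurable (hac.ae_le hfg)
  exact (ae_eq_restrict_iff_indicator_ae_eq hA).1 this

theorem memLp_indicator_comp (hu : Measurable u) (hA : MeasurableSet A)
    (h : (m.restrict A).map u ≤ C • μ) {f : X → ℂ} (hf : MemLp f 2 μ) :
    MemLp (A.indicator (f ∘ u)) 2 m :=
  (memLp_indicator_iff_restrict hA).2
    ((hf.of_measure_le_smul (c := C) ENNReal.coe_ne_top h).comp_of_map hu.aemeasurable)

theorem eLpNorm_indicator_comp_le (hu : Measurable u) (hA : MeasurableSet A)
    (h : (m.restrict A).map u ≤ C • μ) {f : X → ℂ} (hf : MemLp f 2 μ) :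
    eLpNorm (A.indicator (f ∘ u)) 2 m ≤ (C : ℝ≥0∞) ^ (2⁻¹ : ℝ) * eLpNorm f 2 μ := by
  have hf' := hf.of_measure_le_smul (c := C) ENNReal.coe_ne_top h
  rw [eLpNorm_indicator_eq_eLpNorm_restrict hA,
    ← eLpNorm_map_measure hf'.aestronglyMeasurable hu.aemeasurable]
  refine (eLpNorm_le_of_measure_le_smul (c := C) h).trans ?_
  simp

/-- Composition with a measurable map, restricted to a set on which the map has bounded
compression, as an operator between `L²` spaces. -/
theorem exists_indicator_comp_operator (hu : Measurable u) (hA : MeasurableSet A)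
    (h : (m.restrict A).map u ≤ C • μ) :
    ∃ V : Lp ℂ 2 μ →L[ℂ] Lp ℂ 2 m, ∀ f, V f =ᵐ[m] A.indicator (f ∘ u) := by
  let V₀ : Lp ℂ 2 μ →ₗ[ℂ] Lp ℂ 2 m :=
    { toFun := fun f => (memLp_indicator_comp hu hA h (Lp.memLp f)).toLp _
      map_add' := fun f g => by
        rw [← MemLp.toLp_add]
        refine MemLp.toLp_congr _ _ ?_
        refine (indicator_comp_ae_eq hu hA h (Lp.coeFn_add f g)).trans ?_
        refine Filter.Eventually.of_forall fun z => ?_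
        by_cases hz : z ∈ A <;> simp [hz]
      map_smul' := fun c f => by
        rw [RingHom.id_apply, ← MemLp.toLp_const_smul]
        refine MemLp.toLp_congr _ _ ?_
        refine (indicator_comp_ae_eq hu hA h (Lp.coeFn_smul c f)).trans ?_
        refine Filter.Eventually.of_forall fun z => ?_
        by_cases hz : z ∈ A <;> simp [hz] }
  refine ⟨V₀.mkContinuous ((C : ℝ≥0∞) ^ (2⁻¹ : ℝ)).toReal fun f => ?_, fun f => ?_⟩
  · change ‖(memLp_indicator_comp hu hA h (Lp.memLp f)).toLp _‖ ≤ _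
    rw [Lp.norm_toLp, Lp.norm_def, ← ENNReal.toReal_mul]
    refine ENNReal.toReal_mono ?_ (eLpNorm_indicator_comp_le hu hA h (Lp.memLp f))
    exact ENNReal.mul_ne_top (ENNReal.rpow_ne_top_of_nonneg (by norm_num) ENNReal.coe_ne_top)
      (Lp.eLpNorm_ne_top f)
  · exact MemLp.coeFn_toLp (memLp_indicator_comp hu hA h (Lp.memLp f))

end Pullback

/-! ### Embedding `L²(μ₁) ⊗ L²(μ₂)` densely in `L²(μ₁ × μ₂)` -/

section TensorL2

open scoped TensorProduct
open TensorProduct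

variable {X₁ X₂ : Type*} [MeasurableSpace X₁] [MeasurableSpace X₂]
  (μ₁ : Measure X₁) (μ₂ : Measure X₂)

variable {μ₁ μ₂} in
theorem memLp_two_mul_prod {f : X₁ → ℂ} {g : X₂ → ℂ} (hf : MemLp f 2 μ₁) (hg : MemLp g 2 μ₂) :
    MemLp (fun p : X₁ × X₂ => f p.1 * g p.2) 2 (μ₁.prod μ₂) := by
  have hm : AEStronglyMeasurable (fun p : X₁ × X₂ => f p.1 * g p.2) (μ₁.prod μ₂) :=
    hf.aestronglyMeasurable.comp_fst.mul hg.aestronglyMeasurable.comp_snd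
  rw [memLp_two_iff_integrable_sq_norm hm]
  simpa only [norm_mul, mul_pow] using
    ((memLp_two_iff_integrable_sq_norm hf.aestronglyMeasurable).1 hf).mul_prod
      ((memLp_two_iff_integrable_sq_norm hg.aestronglyMeasurable).1 hg)

variable {μ₁ μ₂} in
theorem mul_prod_ae_eq {f f' : X₁ → ℂ} {g g' : X₂ → ℂ} (hf : f =ᵐ[μ₁] f') (hg : g =ᵐ[μ₂] g') :
    (fun p : X₁ × X₂ => f p.1 * g p.2) =ᵐ[μ₁.prod μ₂] fun p => f' p.1 * g' p.2 := by
  filter_upwards [Measure.quasiMeasurePreserving_fst.ae_eq_comp hf,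
    Measure.quasiMeasurePreserving_snd.ae_eq_comp hg] with p h₁ h₂
  simp only [Function.comp_apply] at h₁ h₂
  rw [h₁, h₂]

/-- The bilinear map `(f, g) ↦ f ⊗ g` from `L²(μ₁) × L²(μ₂)` to `L²(μ₁ × μ₂)`. -/
def mulProdL2 : Lp ℂ 2 μ₁ →ₗ[ℂ] Lp ℂ 2 μ₂ →ₗ[ℂ] Lp ℂ 2 (μ₁.prod μ₂) :=
  LinearMap.mk₂ ℂ (fun f g => (memLp_two_mul_prod (Lp.memLp f) (Lp.memLp g)).toLp _)
    (fun f f' g => by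
      rw [← MemLp.toLp_add]
      refine MemLp.toLp_congr _ _
        ((mul_prod_ae_eq (Lp.coeFn_add f f') (ae_eq_refl g)).trans (.of_forall fun p => ?_))
      simp [add_mul])
    (fun c f g => by
      rw [← MemLp.toLp_const_smul]
      refine MemLp.toLp_congr _ _
        ((mul_prod_ae_eq (Lp.coeFn_smul c f) (ae_eq_refl g)).trans (.of_forall fun p => ?_))
      simp [mul_assoc])
    (fun f g g' => by
      rw [← MemLp.toLp_add]
      refine MemLp.toLp_congr _ _
        ((mul_prod_ae_eq (ae_eq_refl f) (Lp.coeFn_add g g')).trans (.of_forall fun p => ?_))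
      simp [mul_add])
    (fun c f g => by
      rw [← MemLp.toLp_const_smul]
      refine MemLp.toLp_congr _ _
        ((mul_prod_ae_eq (ae_eq_refl f) (Lp.coeFn_smul c g)).trans (.of_forall fun p => ?_))
      simp [mul_left_comm])

theorem mulProdL2_coeFn (f : Lp ℂ 2 μ₁) (g : Lp ℂ 2 μ₂) :
    mulProdL2 μ₁ μ₂ f g =ᵐ[μ₁.prod μ₂] fun p => f p.1 * g p.2 :=
  MemLp.coeFn_toLp (memLp_two_mul_prod (Lp.memLp f) (Lp.memLp g))

theorem mulProdL2_indicatorConstLp {A : Set X₁} {B : Set X₂} (hA : MeasurableSet A)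
    (hB : MeasurableSet B) (hA' : μ₁ A ≠ ∞) (hB' : μ₂ B ≠ ∞) (hAB : μ₁.prod μ₂ (A ×ˢ B) ≠ ∞) :
    mulProdL2 μ₁ μ₂ (indicatorConstLp 2 hA hA' 1) (indicatorConstLp 2 hB hB' 1) =
      indicatorConstLp 2 (hA.prod hB) hAB 1 := by
  refine Lp.ext ((mulProdL2_coeFn μ₁ μ₂ _ _).trans ?_)
  refine (mul_prod_ae_eq indicatorConstLp_coeFn indicatorConstLp_coeFn).trans ?_
  refine Filter.EventuallyEq.trans (.of_forall fun p => ?_) indicatorConstLp_coeFn.symm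
  by_cases h₁ : p.1 ∈ A <;> by_cases h₂ : p.2 ∈ B <;> simp [indicator, h₁, h₂, Set.mem_prod]

variable [SigmaFinite μ₁] [SigmaFinite μ₂]

/-- Fubini; this is what makes the embedding of the tensor product isometric. -/
theorem inner_mulProdL2 (f f' : Lp ℂ 2 μ₁) (g g' : Lp ℂ 2 μ₂) :
    ⟪mulProdL2 μ₁ μ₂ f g, mulProdL2 μ₁ μ₂ f' g'⟫_ℂ = ⟪f, f'⟫_ℂ * ⟪g, g'⟫_ℂ := by
  rw [L2.inner_def, L2.inner_def, L2.inner_def, ← integral_prod_mul]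
  refine integral_congr_ae ?_
  filter_upwards [mulProdL2_coeFn μ₁ μ₂ f g, mulProdL2_coeFn μ₁ μ₂ f' g'] with p h h'
  rw [h, h']
  simp only [RCLike.inner_apply, map_mul]
  ring

/-- The isometric embedding of the algebraic tensor product `L²(μ₁) ⊗ L²(μ₂)` into
`L²(μ₁ × μ₂)`. -/
def tensorL2 : Lp ℂ 2 μ₁ ⊗[ℂ] Lp ℂ 2 μ₂ →ₗᵢ[ℂ] Lp ℂ 2 (μ₁.prod μ₂) :=
  (TensorProduct.lift (mulProdL2 μ₁ μ₂)).isometryOfInner fun x y => by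
    induction x with
    | zero => simp
    | add x x' hx hx' => simp only [map_add, inner_add_left, hx, hx']
    | tmul f g =>
      induction y with
      | zero => simp
      | add y y' hy hy' => simp only [map_add, inner_add_right, hy, hy']
      | tmul f' g' => simp [inner_mulProdL2]

theorem tensorL2_tmul (f : Lp ℂ 2 μ₁) (g : Lp ℂ 2 μ₂) :
    tensorL2 μ₁ μ₂ (f ⊗ₜ g) = mulProdL2 μ₁ μ₂ f g := by
  simp [tensorL2]

/-- A function all of whose integrals over rectangles of finite measure vanish is null. -/
theorem ae_eq_zero_of_forall_setIntegral_rectangle_eq_zero {f : X₁ × X₂ → ℂ}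
    (hf : MemLp f 2 (μ₁.prod μ₂))
    (h : ∀ A B, MeasurableSet A → MeasurableSet B → μ₁ A ≠ ∞ → μ₂ B ≠ ∞ →
      ∫ p in A ×ˢ B, f p ∂μ₁.prod μ₂ = 0) :
    f =ᵐ[μ₁.prod μ₂] 0 := by
  -- `f` need not be integrable globally, but on rectangles of finite measure `L²` lies in `L¹`, so
  -- the complex measure with density `f` exists there and rectangles determine it.
  set S : ℕ → Set (X₁ × X₂) := fun n => spanningSets μ₁ n ×ˢ spanningSets μ₂ n with hS
  have hSU : ⋃ n, S n = univ := by
    rw [hS, iUnion_prod_of_monotone (monotone_spanningSets μ₁) (monotone_spanningSets μ₂),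
      iUnion_spanningSets, iUnion_spanningSets, univ_prod_univ]
  have key : ∀ n, f =ᵐ[(μ₁.prod μ₂).restrict (S n)] 0 := fun n => by
    have hfin : IsFiniteMeasure ((μ₁.prod μ₂).restrict (S n)) := ⟨by
      rw [Measure.restrict_apply_univ, hS, Measure.prod_prod]
      exact ENNReal.mul_lt_top (measure_spanningSets_lt_top μ₁ n)
        (measure_spanningSets_lt_top μ₂ n)⟩
    have hint : Integrable f ((μ₁.prod μ₂).restrict (S n)) :=
      (hf.restrict (S n)).integrable one_le_two
    refine hint.ae_eq_of_withDensityᵥ_eq (integrable_zero _ _ _) ?_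
    have hrect : ∀ A B, MeasurableSet A → MeasurableSet B →
        ((μ₁.prod μ₂).restrict (S n)).withDensityᵥ f (A ×ˢ B) = 0 := fun A B hA hB => by
      rw [withDensityᵥ_apply hint (hA.prod hB), Measure.restrict_restrict (hA.prod hB), hS,
        prod_inter_prod]
      exact h _ _ (hA.inter (measurableSet_spanningSets μ₁ n))
        (hB.inter (measurableSet_spanningSets μ₂ n))
        (measure_ne_top_of_subset inter_subset_right (measure_spanningSets_lt_top μ₁ n).ne)
        (measure_ne_top_of_subset inter_subset_right (measure_spanningSets_lt_top μ₂ n).ne)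
    rw [withDensityᵥ_zero]
    refine VectorMeasure.ext_of_generateFrom _ ?_ generateFrom_prod.symm isPiSystem_prod ?_
    · rintro _ ⟨A, hA, B, hB, rfl⟩
      rw [hrect _ _ hA hB]; rfl
    · rw [← univ_prod_univ, hrect _ _ .univ .univ]; rfl
  rw [← Measure.restrict_univ (μ := μ₁.prod μ₂), ← hSU]
  exact (ae_restrict_iUnion_iff S _).2 key

/-- The indicator functions of rectangles of finite measure. -/
def rectangleIndicators : Set (Lp ℂ 2 (μ₁.prod μ₂)) :=
  {f | ∃ (A : Set X₁) (B : Set X₂) (hA : MeasurableSet A) (hB : MeasurableSet B)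
    (hA' : μ₁ A ≠ ∞) (hB' : μ₂ B ≠ ∞),
    f = mulProdL2 μ₁ μ₂ (indicatorConstLp 2 hA hA' 1) (indicatorConstLp 2 hB hB' 1)}

/-- A vector orthogonal to these indicators has zero integral over every rectangle of finite
measure, so it vanishes. -/
theorem dense_span_rectangleIndicators :
    Dense (Submodule.span ℂ (rectangleIndicators μ₁ μ₂) : Set (Lp ℂ 2 (μ₁.prod μ₂))) := by
  rw [Submodule.dense_iff_topologicalClosure_eq_top, Submodule.topologicalClosure_eq_top_iff,
    Submodule.eq_bot_iff]
  intro f hf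
  rw [Submodule.mem_orthogonal] at hf
  refine (Lp.eq_zero_iff_ae_eq_zero).2
    (ae_eq_zero_of_forall_setIntegral_rectangle_eq_zero μ₁ μ₂ (Lp.memLp f) ?_)
  intro A B hA hB hA' hB'
  have hAB : μ₁.prod μ₂ (A ×ˢ B) ≠ ∞ := by
    rw [Measure.prod_prod]; exact ENNReal.mul_ne_top hA' hB'
  have := hf _ (Submodule.subset_span ⟨A, B, hA, hB, hA', hB', rfl⟩)
  rwa [mulProdL2_indicatorConstLp μ₁ μ₂ hA hB hA' hB' hAB,
    L2.inner_indicatorConstLp_one] at this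

theorem denseRange_tensorL2 : DenseRange (tensorL2 μ₁ μ₂) := by
  have hle : Submodule.span ℂ (rectangleIndicators μ₁ μ₂) ≤
      LinearMap.range (tensorL2 μ₁ μ₂).toLinearMap := Submodule.span_le.2 ?_
  · exact (dense_span_rectangleIndicators μ₁ μ₂).mono hle
  rintro _ ⟨A, B, hA, hB, hA', hB', rfl⟩
  exact ⟨_, tensorL2_tmul μ₁ μ₂ _ _⟩

end TensorL2

/-! ### Existence of pseudo-integral operators -/

section PseudoIntegral

/-- The integral is formed with a pairing that is only `ℝ`-bilinear, so complex homogeneity is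
deduced from that of `x ↦ x * σ s`. -/
theorem integral_complexMeasure_const_mul {Z : Type*} [MeasurableSpace Z] (σ : ComplexMeasure Z)
    (c : ℂ) (f : Z → ℂ) :
    σ.integral (fun z => c * f z) (ContinuousLinearMap.mul ℝ ℂ) =
      c * σ.integral f (ContinuousLinearMap.mul ℝ ℂ) := by
  rw [VectorMeasure.integral_eq_setToFun, VectorMeasure.integral_eq_setToFun]
  refine setToFun_smul (𝕜 := ℂ) _ (fun c s x => ?_) c f
  change (c • x) * σ s = c • (x * σ s)
  simp [mul_assoc]

theorem integrable_mul_conj {Z : Type*} [MeasurableSpace Z] {m : Measure Z} {a b : Z → ℂ}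
    (ha : MemLp a 2 m) (hb : MemLp b 2 m) :
    Integrable (fun z => b z * starRingEnd ℂ (a z)) m :=
  hb.integrable_mul ha.star

/-- Cauchy–Schwarz in `L²(|σ|)`. -/
theorem norm_integral_mul_conj_le {Z : Type*} [MeasurableSpace Z] (σ : ComplexMeasure Z)
    (a b : Lp ℂ 2 σ.variation) :
    ‖σ.integral (fun z => b z * starRingEnd ℂ (a z)) (ContinuousLinearMap.mul ℝ ℂ)‖ ≤
      ‖a‖ * ‖b‖ := by
  have h₁ := (VectorMeasure.enorm_integral_le_lintegral_enorm (μ := σ)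
    (B := ContinuousLinearMap.mul ℝ ℂ) (f := fun z => b z * starRingEnd ℂ (a z)))
  have h₂ : ‖ContinuousLinearMap.mul ℝ ℂ‖ₑ ≤ 1 := by
    rw [← ofReal_norm]
    exact ENNReal.ofReal_le_one.2 (ContinuousLinearMap.opNorm_mul_le ℝ ℂ)
  have h₃ : ∫⁻ z, ‖b z * starRingEnd ℂ (a z)‖ₑ ∂σ.variation ≤
      eLpNorm b 2 σ.variation * eLpNorm a 2 σ.variation := by
    have := eLpNorm_smul_le_mul_eLpNorm (p := 2) (q := 2) (r := 1) (Lp.aestronglyMeasurable a).star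
      (Lp.aestronglyMeasurable b)
    rw [eLpNorm_one_eq_lintegral_enorm] at this
    simpa using this
  have h₄ : ‖σ.integral (fun z => b z * starRingEnd ℂ (a z)) (ContinuousLinearMap.mul ℝ ℂ)‖ₑ ≤
      eLpNorm b 2 σ.variation * eLpNorm a 2 σ.variation :=
    h₁.trans ((mul_le_mul' h₂ h₃).trans (one_mul _).le)
  rw [mul_comm, Lp.norm_def, Lp.norm_def, ← ENNReal.toReal_mul, ← toReal_enorm]
  exact ENNReal.toReal_mono (ENNReal.mul_ne_top (Lp.eLpNorm_ne_top b) (Lp.eLpNorm_ne_top a)) h₄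

/-- The sesquilinear form `(a, b) ↦ ∫ b * conj a dσ` on `L²(|σ|)` is given by an operator. -/
theorem exists_operator_inner_eq_integral {Z : Type*} [MeasurableSpace Z] (σ : ComplexMeasure Z) :
    ∃ M : Lp ℂ 2 σ.variation →L[ℂ] Lp ℂ 2 σ.variation, ∀ a b, ⟪a, M b⟫_ℂ =
      σ.integral (fun z => b z * starRingEnd ℂ (a z)) (ContinuousLinearMap.mul ℝ ℂ) := by
  have hint : ∀ a b : Lp ℂ 2 σ.variation,
      Integrable (fun z => b z * starRingEnd ℂ (a z)) σ.variation := fun a b =>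
    integrable_mul_conj (Lp.memLp a) (Lp.memLp b)
  let Φ : Lp ℂ 2 σ.variation →ₗ⋆[ℂ] Lp ℂ 2 σ.variation →ₗ[ℂ] ℂ :=
    LinearMap.mk₂'ₛₗ (starRingEnd ℂ) (RingHom.id ℂ)
      (fun a b => σ.integral (fun z => b z * starRingEnd ℂ (a z)) (ContinuousLinearMap.mul ℝ ℂ))
      (fun a a' b => by
        rw [← VectorMeasure.integral_fun_add (hint a b) (hint a' b)]
        refine VectorMeasure.integral_congr_ae ?_
        filter_upwards [Lp.coeFn_add a a'] with z hz
        rw [hz, Pi.add_apply, map_add, mul_add])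
      (fun c a b => by
        rw [smul_eq_mul, ← integral_complexMeasure_const_mul]
        refine VectorMeasure.integral_congr_ae ?_
        filter_upwards [Lp.coeFn_smul c a] with z hz
        simp [hz, mul_left_comm])
      (fun a b b' => by
        rw [← VectorMeasure.integral_fun_add (hint a b) (hint a b')]
        refine VectorMeasure.integral_congr_ae ?_
        filter_upwards [Lp.coeFn_add b b'] with z hz
        rw [hz, Pi.add_apply, add_mul])
      (fun c a b => by
        rw [RingHom.id_apply, smul_eq_mul, ← integral_complexMeasure_const_mul]
        refine VectorMeasure.integral_congr_ae ?_
        filter_upwards [Lp.coeFn_smul c b] with z hz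
        simp [hz, mul_assoc])
  let Ψ := Φ.mkContinuous₂ 1 fun a b => by
    rw [one_mul]; exact norm_integral_mul_conj_le σ a b
  -- The operator representing `Ψ` acts on the conjugate-linear variable `a`; its adjoint acts on
  -- `b`.
  refine ⟨ContinuousLinearMap.adjoint (InnerProductSpace.continuousLinearMapOfBilin Ψ),
    fun a b => ?_⟩
  rw [ContinuousLinearMap.adjoint_inner_right,
    InnerProductSpace.continuousLinearMapOfBilin_apply]
  rfl

variable {X Y : Type*} [MeasurableSpace X] [MeasurableSpace Y] {μ : Measure X} {ν : Measure Y}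

theorem memLp_comp_of_map_le {Z : Type*} [MeasurableSpace Z] {m : Measure Z} {u : Z → X}
    (hu : Measurable u) {c : ℝ≥0} (h : m.map u ≤ c • μ) {f : X → ℂ} (hf : MemLp f 2 μ) :
    MemLp (f ∘ u) 2 m :=
  (hf.of_measure_le_smul (c := c) ENNReal.coe_ne_top h).comp_of_map hu.aemeasurable

theorem integrable_mul_conj_of_marginals_le {m : Measure (Y × X)} {c : ℝ≥0}
    (h₁ : m.map Prod.fst ≤ c • ν) (h₂ : m.map Prod.snd ≤ c • μ) {f : X → ℂ} {g : Y → ℂ}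
    (hf : MemLp f 2 μ) (hg : MemLp g 2 ν) :
    Integrable (fun p : Y × X => f p.2 * starRingEnd ℂ (g p.1)) m :=
  integrable_mul_conj (memLp_comp_of_map_le measurable_fst h₁ hg)
    (memLp_comp_of_map_le measurable_snd h₂ hf)

variable {σ : ComplexMeasure (Y × X)}

theorem IsArvesonMeasure.ae_fst (hσ : IsArvesonMeasure ν μ σ) {p : Y → Prop}
    (h : ∀ᵐ y ∂ν, p y) : ∀ᵐ z ∂σ.variation, p z.1 := by
  obtain ⟨-, c, -, hc, -⟩ := hσ
  exact ae_of_ae_map measurable_fst.aemeasurable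
    ((Measure.absolutelyContinuous_of_le_smul hc).ae_le h)

theorem IsArvesonMeasure.ae_snd (hσ : IsArvesonMeasure ν μ σ) {p : X → Prop}
    (h : ∀ᵐ x ∂μ, p x) : ∀ᵐ z ∂σ.variation, p z.2 := by
  obtain ⟨-, c, -, -, hc⟩ := hσ
  exact ae_of_ae_map measurable_snd.aemeasurable
    ((Measure.absolutelyContinuous_of_le_smul hc).ae_le h)

/-- Every Arveson measure has a pseudo-integral operator. -/
theorem IsArvesonMeasure.exists_isPseudoIntegral (hσ : IsArvesonMeasure ν μ σ) :
    ∃ T, IsPseudoIntegral μ ν σ T := by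
  obtain ⟨M, hM⟩ := exists_operator_inner_eq_integral σ
  obtain ⟨-, c, -, hc₁, hc₂⟩ := hσ
  obtain ⟨V, hV⟩ := exists_indicator_comp_operator (μ := μ) (m := σ.variation) (A := univ)
    measurable_snd .univ (by simpa using hc₂)
  obtain ⟨W, hW⟩ := exists_indicator_comp_operator (μ := ν) (m := σ.variation) (A := univ)
    measurable_fst .univ (by simpa using hc₁)
  -- `V` and `W` pull functions on `X` and `Y` back to `L²(|σ|)`, boundedly by the marginal
  -- conditions, and `T_σ = W* M V`.
  refine ⟨ContinuousLinearMap.adjoint W ∘L M ∘L V, fun f g => ?_⟩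
  rw [ContinuousLinearMap.comp_apply, ContinuousLinearMap.comp_apply,
    ContinuousLinearMap.adjoint_inner_right, hM]
  refine VectorMeasure.integral_congr_ae ?_
  filter_upwards [hV f, hW g] with z h₁ h₂
  simp [h₁, h₂]

/-- Matrix coefficients at indicators recover the measure on rectangles; this identifies the
operator of a product measure. -/
theorem IsPseudoIntegral.inner_indicatorConstLp {T : Lp ℂ 2 μ →L[ℂ] Lp ℂ 2 ν}
    (hT : IsPseudoIntegral μ ν σ T) (hσ : IsArvesonMeasure ν μ σ) {A : Set X} {B : Set Y}
    (hA : MeasurableSet A) (hB : MeasurableSet B) (hA' : μ A ≠ ∞) (hB' : ν B ≠ ∞) :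
    ⟪indicatorConstLp 2 hB hB' (1 : ℂ), T (indicatorConstLp 2 hA hA' (1 : ℂ))⟫_ℂ =
      σ (B ×ˢ A) := by
  have := hσ.1
  have hBA := hB.prod hA
  rw [hT]
  have : (fun p : Y × X => indicatorConstLp 2 hA hA' (1 : ℂ) p.2 *
      starRingEnd ℂ (indicatorConstLp 2 hB hB' (1 : ℂ) p.1)) =ᵐ[σ.variation]
      (B ×ˢ A).indicator fun _ => (1 : ℂ) := by
    filter_upwards [
      hσ.ae_snd (indicatorConstLp_coeFn (p := 2) (hs := hA) (hμs := hA') (c := (1 : ℂ))),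
      hσ.ae_fst (indicatorConstLp_coeFn (p := 2) (hs := hB) (hμs := hB') (c := (1 : ℂ)))]
      with p h₁ h₂
    rw [h₁, h₂]
    by_cases h₁ : p.1 ∈ B <;> by_cases h₂ : p.2 ∈ A <;> simp [indicator, h₁, h₂, Set.mem_prod]
  rw [VectorMeasure.integral_congr_ae this, VectorMeasure.integral_indicator hBA,
    VectorMeasure.integral_const]
  simp [VectorMeasure.restrict_apply, hBA]

end PseudoIntegral

/-! ### ω-closed sets and their products -/

section OmegaClosed

variable {X Y : Type*} [MeasurableSpace X] [MeasurableSpace Y] {μ : Measure X} {ν : Measure Y}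

/-- The complement of an ω-closed set is covered, up to null fibres, by a countable union of
rectangles which, up to null fibres, does not meet the set. -/
theorem IsOmegaClosed.exists_rectangles {κ : Set (X × Y)} (h : IsOmegaClosed μ ν κ) :
    ∃ (P : ℕ → Set X) (Q : ℕ → Set Y) (X₀ : Set X) (Y₀ : Set Y),
      (∀ n, MeasurableSet (P n)) ∧ (∀ n, MeasurableSet (Q n)) ∧ μ X₀ = 0 ∧ ν Y₀ = 0 ∧
      ∀ x ∉ X₀, ∀ y ∉ Y₀, (x, y) ∈ κ ↔ ∀ n, x ∈ P n → y ∉ Q n := by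
  obtain ⟨P, Q, hP, hQ, X₀, Y₀, hX₀, hY₀, hsub⟩ := h
  refine ⟨P, Q, X₀, Y₀, hP, hQ, hX₀, hY₀, fun x hx y hy => ?_⟩
  have hnot : (x, y) ∉ κᶜ ∆ ⋃ n, P n ×ˢ Q n := fun hmem => by
    rcases hsub hmem with h | h
    · exact hx h.1
    · exact hy h.2
  rw [Set.mem_symmDiff] at hnot
  have hU : (x, y) ∈ ⋃ n, P n ×ˢ Q n ↔ ∃ n, x ∈ P n ∧ y ∈ Q n := by simp
  rw [hU, mem_compl_iff] at hnot
  constructor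
  · intro hκ n hn hn'
    exact hnot (Or.inr ⟨⟨n, hn, hn'⟩, not_not.2 hκ⟩)
  · intro hall
    by_contra hκ
    exact hnot (Or.inl ⟨hκ, fun ⟨n, hn, hn'⟩ => hall n hn hn'⟩)

theorem rho_image_prod {X₁ X₂ Y₁ Y₂ : Type*} (κ₁ : Set (X₁ × Y₁)) (κ₂ : Set (X₂ × Y₂)) :
    rho '' (κ₁ ×ˢ κ₂) = {p | (p.1.1, p.2.1) ∈ κ₁ ∧ (p.1.2, p.2.2) ∈ κ₂} := by
  ext ⟨⟨x₁, x₂⟩, y₁, y₂⟩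
  constructor
  · rintro ⟨p, hp, hpe⟩
    simp only [rho, Prod.mk.injEq] at hpe
    obtain ⟨⟨rfl, rfl⟩, rfl, rfl⟩ := hpe
    exact hp
  · rintro h
    exact ⟨((x₁, y₁), (x₂, y₂)), h, rfl⟩

/-- The complement is the union of the cylinders over the two complements, and the cylinder over a
rectangle is a rectangle. The index set `ℕ ⊕ ℕ` is then re-enumerated by `ℕ`. -/
theorem IsOmegaClosed.rho_image {X₁ X₂ Y₁ Y₂ : Type*} [MeasurableSpace X₁] [MeasurableSpace X₂]
    [MeasurableSpace Y₁] [MeasurableSpace Y₂] {μ₁ : Measure X₁} {μ₂ : Measure X₂}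
    {ν₁ : Measure Y₁} {ν₂ : Measure Y₂} [SFinite μ₂] [SFinite ν₂]
    {κ₁ : Set (X₁ × Y₁)} {κ₂ : Set (X₂ × Y₂)} (h₁ : IsOmegaClosed μ₁ ν₁ κ₁)
    (h₂ : IsOmegaClosed μ₂ ν₂ κ₂) :
    IsOmegaClosed (μ₁.prod μ₂) (ν₁.prod ν₂) (rho '' (κ₁ ×ˢ κ₂)) := by
  obtain ⟨P₁, Q₁, X₁', Y₁', hP₁, hQ₁, hX₁, hY₁, hκ₁⟩ := h₁.exists_rectangles
  obtain ⟨P₂, Q₂, X₂', Y₂', hP₂, hQ₂, hX₂, hY₂, hκ₂⟩ := h₂.exists_rectangles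
  let e := Equiv.natSumNatEquivNat
  let P : ℕ ⊕ ℕ → Set (X₁ × X₂) := Sum.elim (fun n => P₁ n ×ˢ univ) fun n => univ ×ˢ P₂ n
  let Q : ℕ ⊕ ℕ → Set (Y₁ × Y₂) := Sum.elim (fun n => Q₁ n ×ˢ univ) fun n => univ ×ˢ Q₂ n
  have hP : ∀ i, MeasurableSet (P i) := by
    rintro (n | n)
    · exact (hP₁ n).prod .univ
    · exact MeasurableSet.univ.prod (hP₂ n)
  have hQ : ∀ i, MeasurableSet (Q i) := by
    rintro (n | n)
    · exact (hQ₁ n).prod .univ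
    · exact MeasurableSet.univ.prod (hQ₂ n)
  refine ⟨fun n => P (e.symm n), fun n => Q (e.symm n), fun n => hP _, fun n => hQ _,
    X₁' ×ˢ univ ∪ univ ×ˢ X₂', Y₁' ×ˢ univ ∪ univ ×ˢ Y₂', ?_, ?_, ?_⟩
  · simp [measure_union_null_iff, Measure.prod_prod, hX₁, hX₂]
  · simp [measure_union_null_iff, Measure.prod_prod, hY₁, hY₂]
  · rw [e.symm.surjective.iUnion_comp (fun i => P i ×ˢ Q i), rho_image_prod]
    rintro ⟨⟨x₁, x₂⟩, y₁, y₂⟩ hmem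
    by_contra hnot
    simp only [mem_union, mem_prod, mem_univ, and_true, true_and, not_or] at hnot
    obtain ⟨⟨hx₁, hx₂⟩, hy₁, hy₂⟩ := hnot
    simp only [Set.mem_symmDiff, mem_compl_iff, mem_ofPred_eq, hκ₁ _ hx₁ _ hy₁, hκ₂ _ hx₂ _ hy₂,
      mem_iUnion, Sum.exists, P, Q, Sum.elim_inl, Sum.elim_inr, mem_prod, mem_univ, and_true,
      true_and] at hmem
    grind

end OmegaClosed

/-! ### Slices: restriction to a rectangle followed by push-forward -/

section Slice

variable {X Y X' Y' : Type*} [MeasurableSpace X] [MeasurableSpace Y] [MeasurableSpace X']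
  [MeasurableSpace Y'] {μ : Measure X} {ν : Measure Y} {μ' : Measure X'} {ν' : Measure Y'}

/-- The image under `v × u` of the restriction of `σ` to the rectangle `B × A`. -/
def sliceMeasure (σ : ComplexMeasure (Y × X)) (u : X → X') (v : Y → Y') (A : Set X) (B : Set Y) :
    ComplexMeasure (Y' × X') :=
  (σ.restrict (B ×ˢ A)).map (Prod.map v u)

variable {σ : ComplexMeasure (Y × X)} {u : X → X'} {v : Y → Y'} {A : Set X} {B : Set Y} {C : ℝ≥0}

theorem variation_sliceMeasure_le (hu : Measurable u) (hv : Measurable v) :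
    (sliceMeasure σ u v A B).variation ≤
      (σ.variation.restrict (B ×ˢ A)).map (Prod.map v u) :=
  VectorMeasure.variation_map_le.trans
    (Measure.map_mono VectorMeasure.variation_restrict_le (hv.prodMap hu))

/-- Enlarging the rectangle to the strip over `A` leaves only the second marginal of `m`, restricted
to `A`, to be pushed along `u`. -/
theorem map_snd_map_restrict_le (hu : Measurable u) (hv : Measurable v) (hA : MeasurableSet A)
    (hμ : (μ.restrict A).map u ≤ C • μ') {m : Measure (Y × X)} {c : ℝ≥0}
    (hm : m.map Prod.snd ≤ c • μ) :
    ((m.restrict (B ×ˢ A)).map (Prod.map v u)).map Prod.snd ≤ (c * C) • μ' := by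
  rw [Measure.map_map measurable_snd (hv.prodMap hu)]
  change (m.restrict (B ×ˢ A)).map (u ∘ Prod.snd) ≤ _
  rw [← Measure.map_map hu measurable_snd]
  calc ((m.restrict (B ×ˢ A)).map Prod.snd).map u
      ≤ ((m.restrict (Prod.snd ⁻¹' A)).map Prod.snd).map u :=
        Measure.map_mono (Measure.map_mono
          (Measure.restrict_mono_set _ fun p hp => hp.2) measurable_snd) hu
    _ = ((m.map Prod.snd).restrict A).map u := by
        rw [Measure.restrict_map measurable_snd hA]
    _ ≤ ((c • μ).restrict A).map u :=
        Measure.map_mono (Measure.restrict_mono_measure hm A) hu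
    _ = c • (μ.restrict A).map u := by
        rw [Measure.restrict_smul, Measure.map_smul]
    _ ≤ c • C • μ' := by gcongr
    _ = (c * C) • μ' := smul_smul _ _ _

theorem map_fst_map_restrict_le (hu : Measurable u) (hv : Measurable v) (hB : MeasurableSet B)
    (hν : (ν.restrict B).map v ≤ C • ν') {m : Measure (Y × X)} {c : ℝ≥0}
    (hm : m.map Prod.fst ≤ c • ν) :
    ((m.restrict (B ×ˢ A)).map (Prod.map v u)).map Prod.fst ≤ (c * C) • ν' := by
  rw [Measure.map_map measurable_fst (hv.prodMap hu)]
  change (m.restrict (B ×ˢ A)).map (v ∘ Prod.fst) ≤ _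
  rw [← Measure.map_map hv measurable_fst]
  calc ((m.restrict (B ×ˢ A)).map Prod.fst).map v
      ≤ ((m.restrict (Prod.fst ⁻¹' B)).map Prod.fst).map v :=
        Measure.map_mono (Measure.map_mono
          (Measure.restrict_mono_set _ fun p hp => hp.1) measurable_fst) hv
    _ = ((m.map Prod.fst).restrict B).map v := by
        rw [Measure.restrict_map measurable_fst hB]
    _ ≤ ((c • ν).restrict B).map v :=
        Measure.map_mono (Measure.restrict_mono_measure hm B) hv
    _ = c • (ν.restrict B).map v := by
        rw [Measure.restrict_smul, Measure.map_smul]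
    _ ≤ c • C • ν' := by gcongr
    _ = (c * C) • ν' := smul_smul _ _ _

/-- Slices of Arveson measures are Arveson measures. -/
theorem IsArvesonMeasure.sliceMeasure (hσ : IsArvesonMeasure ν μ σ) (hu : Measurable u)
    (hv : Measurable v) (hA : MeasurableSet A) (hB : MeasurableSet B) (hC : 0 < C)
    (hμ : (μ.restrict A).map u ≤ C • μ') (hν : (ν.restrict B).map v ≤ C • ν') :
    IsArvesonMeasure ν' μ' (sliceMeasure σ u v A B) := by
  obtain ⟨hfin, c, hc, hc₁, hc₂⟩ := hσ
  refine ⟨by unfold OperatorM0.sliceMeasure; infer_instance, c * C, mul_pos hc hC, ?_, ?_⟩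
  · exact (Measure.map_mono (variation_sliceMeasure_le hu hv) measurable_fst).trans
      (map_fst_map_restrict_le hu hv hB hν hc₁)
  · exact (Measure.map_mono (variation_sliceMeasure_le hu hv) measurable_snd).trans
      (map_snd_map_restrict_le hu hv hA hμ hc₂)

/-- The pseudo-integral operator of a slice is a compression of that of the measure. -/
theorem IsPseudoIntegral.exists_sliceMeasure {T : Lp ℂ 2 μ →L[ℂ] Lp ℂ 2 ν}
    (hT : IsPseudoIntegral μ ν σ T) (hσ : IsArvesonMeasure ν μ σ) (hu : Measurable u)
    (hv : Measurable v) (hA : MeasurableSet A) (hB : MeasurableSet B)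
    (hμ : (μ.restrict A).map u ≤ C • μ') (hν : (ν.restrict B).map v ≤ C • ν') :
    ∃ T' : Lp ℂ 2 μ' →L[ℂ] Lp ℂ 2 ν',
      IsPseudoIntegral μ' ν' (OperatorM0.sliceMeasure σ u v A B) T' ∧
      (IsCompactOperator T → IsCompactOperator T') := by
  obtain ⟨V, hV⟩ := exists_indicator_comp_operator hu hA hμ
  obtain ⟨W, hW⟩ := exists_indicator_comp_operator hv hB hν
  refine ⟨ContinuousLinearMap.adjoint W ∘L T ∘L V, fun f g => ?_, fun h =>
    (h.comp_clm V).clm_comp (ContinuousLinearMap.adjoint W)⟩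
  obtain ⟨-, c, -, hc₁, hc₂⟩ := id hσ
  have hBA := hB.prod hA
  have hint : Integrable (fun p : Y' × X' => f p.2 * starRingEnd ℂ (g p.1))
      ((σ.variation.restrict (B ×ˢ A)).map (Prod.map v u)) :=
    integrable_mul_conj_of_marginals_le (map_fst_map_restrict_le hu hv hB hν hc₁)
      (map_snd_map_restrict_le hu hv hA hμ hc₂) (Lp.memLp f) (Lp.memLp g)
  rw [OperatorM0.sliceMeasure, VectorMeasure.integral_map (hv.prodMap hu)
      (by rw [VectorMeasure.variation_restrict hBA]; exact hint.aestronglyMeasurable)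
      (by
        unfold VectorMeasure.Integrable
        rw [VectorMeasure.variation_restrict hBA]
        exact hint.comp_measurable (hv.prodMap hu)),
    ← VectorMeasure.integral_indicator hBA, ContinuousLinearMap.comp_apply,
    ContinuousLinearMap.comp_apply, ContinuousLinearMap.adjoint_inner_right, hT]
  refine VectorMeasure.integral_congr_ae ?_
  filter_upwards [hσ.ae_snd (hV f), hσ.ae_fst (hW g)] with p h₁ h₂
  rw [h₁, h₂]
  by_cases h₁ : p.1 ∈ B <;> by_cases h₂ : p.2 ∈ A <;> simp [indicator, h₁, h₂, Set.mem_prod]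

/-- If `v × u` maps `κ ∩ (A × B)` into the ω-closed set `κ'`, then slices of Arveson measures
supported on `κ̂` are supported on `κ̂'`. -/
theorem variation_sliceMeasure_compl_eq_zero (hσ : IsArvesonMeasure ν μ σ) (hu : Measurable u)
    (hv : Measurable v) (hA : MeasurableSet A) (hB : MeasurableSet B) (hC : 0 < C)
    (hμ : (μ.restrict A).map u ≤ C • μ') (hν : (ν.restrict B).map v ≤ C • ν')
    {κ : Set (X × Y)} {κ' : Set (X' × Y')} (hκ : σ.variation (hat κ)ᶜ = 0)
    (hκ' : IsOmegaClosed μ' ν' κ')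
    (hmap : ∀ x ∈ A, ∀ y ∈ B, (x, y) ∈ κ → (u x, v y) ∈ κ') :
    (sliceMeasure σ u v A B).variation (hat κ')ᶜ = 0 := by
  have hσ' := hσ.sliceMeasure hu hv hA hB hC hμ hν
  obtain ⟨P, Q, X₀, Y₀, hP, hQ, hX₀, hY₀, hPQ⟩ := hκ'.exists_rectangles
  obtain ⟨-, c, -, hc₁, hc₂⟩ := id hσ
  set m := σ.variation.restrict (B ×ˢ A) with hm
  set U : Set (Y' × X') := ⋃ n, Q n ×ˢ P n with hU
  have hUm : MeasurableSet U := .iUnion fun n => (hQ n).prod (hP n)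
  have hvu := hv.prodMap hu
  have hX₀' : ∀ᵐ p ∂m, u p.2 ∉ X₀ := by
    have h₁ : ∀ᵐ x ∂(m.map (Prod.map v u)).map Prod.snd, x ∉ X₀ :=
      (Measure.absolutelyContinuous_of_le_smul (map_snd_map_restrict_le hu hv hA hμ hc₂)).ae_le
        (measure_eq_zero_iff_ae_notMem.1 hX₀)
    exact ae_of_ae_map hvu.aemeasurable (ae_of_ae_map measurable_snd.aemeasurable h₁)
  have hY₀' : ∀ᵐ p ∂m, v p.1 ∉ Y₀ := by
    have h₁ : ∀ᵐ y ∂(m.map (Prod.map v u)).map Prod.fst, y ∉ Y₀ :=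
      (Measure.absolutelyContinuous_of_le_smul (map_fst_map_restrict_le hu hv hB hν hc₁)).ae_le
        (measure_eq_zero_iff_ae_notMem.1 hY₀)
    exact ae_of_ae_map hvu.aemeasurable (ae_of_ae_map measurable_fst.aemeasurable h₁)
  -- `κ` and `κ'` need not be measurable, so nullity is pulled back only for the measurable union
  -- `U`; the exceptional fibres are handled by the marginals.
  have hU0 : ∀ᵐ q ∂(sliceMeasure σ u v A B).variation, q ∉ U := by
    refine (Measure.absolutelyContinuous_of_le (variation_sliceMeasure_le hu hv)).ae_le ?_
    refine (ae_map_iff hvu.aemeasurable hUm.compl).2 ?_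
    filter_upwards [hX₀', hY₀', ae_restrict_mem (hB.prod hA),
      ae_restrict_of_ae (measure_eq_zero_iff_ae_notMem.1 hκ)] with p h₁ h₂ h₃ h₄
    have h₅ := (hPQ _ h₁ _ h₂).1 (hmap _ h₃.2 _ h₃.1 (not_not.1 h₄))
    rw [hU, mem_iUnion]
    rintro ⟨n, hn⟩
    exact h₅ n hn.2 hn.1
  refine measure_eq_zero_iff_ae_notMem.2 ?_
  filter_upwards [hU0, hσ'.ae_snd (measure_eq_zero_iff_ae_notMem.1 hX₀),
    hσ'.ae_fst (measure_eq_zero_iff_ae_notMem.1 hY₀)] with q h₁ h₂ h₃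
  refine not_not.2 ((hPQ _ h₂ _ h₃).2 fun n hn hn' => h₁ ?_)
  exact mem_iUnion.2 ⟨n, hn', hn⟩

/-- A nonzero slice of an Arveson measure with compact pseudo-integral operator witnesses an
operator `M₀`-set. -/
theorem isOperatorM0Set_of_sliceMeasure_ne_zero {κ : Set (X × Y)} {κ' : Set (X' × Y')}
    (hσ : σ ∈ arvesonMeasures ν μ (hat κ)) {T : Lp ℂ 2 μ →L[ℂ] Lp ℂ 2 ν}
    (hT : IsPseudoIntegral μ ν σ T) (hTc : IsCompactOperator T) (hu : Measurable u)
    (hv : Measurable v) (hA : MeasurableSet A) (hB : MeasurableSet B) (hC : 0 < C)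
    (hμ : (μ.restrict A).map u ≤ C • μ') (hν : (ν.restrict B).map v ≤ C • ν')
    (hκ' : IsOmegaClosed μ' ν' κ')
    (hmap : ∀ x ∈ A, ∀ y ∈ B, (x, y) ∈ κ → (u x, v y) ∈ κ')
    (hne : sliceMeasure σ u v A B ≠ 0) : IsOperatorM0Set μ' ν' κ' := by
  obtain ⟨T', hT', hTc'⟩ := hT.exists_sliceMeasure hσ.1 hu hv hA hB hμ hν
  exact ⟨hκ', _, ⟨hσ.1.sliceMeasure hu hv hA hB hC hμ hν,
    variation_sliceMeasure_compl_eq_zero hσ.1 hu hv hA hB hC hμ hν hσ.2 hκ' hmap⟩, hne, T', hT',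
    hTc' hTc⟩

end Slice

/-! ### From the product set to its factors -/

section Forward

/-- The map `rho` as a measurable equivalence. -/
def rhoEquiv (α β γ δ : Type*) [MeasurableSpace α] [MeasurableSpace β] [MeasurableSpace γ]
    [MeasurableSpace δ] : (α × β) × (γ × δ) ≃ᵐ (α × γ) × (β × δ) where
  toEquiv := Equiv.prodProdProdComm α β γ δ
  measurable_toFun := by
    change Measurable fun p : (α × β) × (γ × δ) => ((p.1.1, p.2.1), (p.1.2, p.2.2))
    fun_prop
  measurable_invFun := by
    change Measurable fun p : (α × γ) × (β × δ) => ((p.1.1, p.2.1), (p.1.2, p.2.2))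
    fun_prop

theorem rhoEquiv_apply {α β γ δ : Type*} [MeasurableSpace α] [MeasurableSpace β]
    [MeasurableSpace γ] [MeasurableSpace δ] (p : (α × β) × (γ × δ)) :
    rhoEquiv α β γ δ p = ((p.1.1, p.2.1), (p.1.2, p.2.2)) := rfl

theorem map_measurableEquiv_ne_zero {α β : Type*} [MeasurableSpace α] [MeasurableSpace β]
    (e : α ≃ᵐ β) {σ : ComplexMeasure α} (hσ : σ ≠ 0) : σ.map e ≠ 0 := fun h => hσ <| by
  ext s hs
  have := VectorMeasure.map_apply σ e.measurable (e.symm.measurable hs)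
  rw [h, ← preimage_comp, MeasurableEquiv.symm_comp_self, preimage_id] at this
  exact this.symm

/-- A complex measure on a product vanishing on the rectangles of finite measure vanishes. -/
theorem complexMeasure_eq_zero_of_forall_rectangle {X Y : Type*} [MeasurableSpace X]
    [MeasurableSpace Y] (μ : Measure X) (ν : Measure Y) [SigmaFinite μ] [SigmaFinite ν]
    {τ : ComplexMeasure (Y × X)}
    (h : ∀ A B, MeasurableSet A → MeasurableSet B → μ A ≠ ∞ → ν B ≠ ∞ → τ (B ×ˢ A) = 0) :
    τ = 0 := by
  have hrect : ∀ A B, MeasurableSet A → MeasurableSet B → τ (B ×ˢ A) = 0 := fun A B hA hB => by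
    -- Exhausting a rectangle by rectangles of finite measure and using continuity of `τ` from below
    -- removes the finiteness condition.
    set S : ℕ → Set (Y × X) := fun n => (B ∩ spanningSets ν n) ×ˢ (A ∩ spanningSets μ n) with hS
    have hmB : Monotone fun n => B ∩ spanningSets ν n := fun i j hij =>
      inter_subset_inter_right _ (monotone_spanningSets ν hij)
    have hmA : Monotone fun n => A ∩ spanningSets μ n := fun i j hij =>
      inter_subset_inter_right _ (monotone_spanningSets μ hij)
    have hBm : ∀ n, MeasurableSet (B ∩ spanningSets ν n) := fun n =>
      hB.inter (measurableSet_spanningSets ν n)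
    have hAm : ∀ n, MeasurableSet (A ∩ spanningSets μ n) := fun n =>
      hA.inter (measurableSet_spanningSets μ n)
    have hU : ⋃ n, S n = B ×ˢ A := by
      rw [hS, iUnion_prod_of_monotone hmB hmA, ← inter_iUnion, ← inter_iUnion,
        iUnion_spanningSets, iUnion_spanningSets, inter_univ, inter_univ]
    have hlim := τ.tendsto_vectorMeasure_iUnion_atTop_nat (s := S)
      (fun i j hij => prod_mono (hmB hij) (hmA hij)) fun n => (hBm n).prod (hAm n)
    have hz : ∀ n, τ (S n) = 0 := fun n => h _ _ (hAm n) (hBm n)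
      (measure_ne_top_of_subset inter_subset_right (measure_spanningSets_lt_top μ n).ne)
      (measure_ne_top_of_subset inter_subset_right (measure_spanningSets_lt_top ν n).ne)
    rw [hU] at hlim
    simp only [hz] at hlim
    exact tendsto_nhds_unique hlim tendsto_const_nhds
  refine VectorMeasure.ext_of_generateFrom _ ?_ generateFrom_prod.symm isPiSystem_prod ?_
  · rintro _ ⟨B, hB, A, hA, rfl⟩
    rw [hrect A B hA hB]; rfl
  · rw [← univ_prod_univ, hrect _ _ .univ .univ]; rfl

variable {X₁ X₂ Y₁ Y₂ : Type*} [MeasurableSpace X₁] [MeasurableSpace X₂] [MeasurableSpace Y₁]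
  [MeasurableSpace Y₂] {μ₁ : Measure X₁} {μ₂ : Measure X₂} {ν₁ : Measure Y₁} {ν₂ : Measure Y₂}
  [SigmaFinite μ₁] [SigmaFinite μ₂] [SigmaFinite ν₁] [SigmaFinite ν₂]

omit [SigmaFinite μ₁] [SigmaFinite ν₁] in
variable (μ₂ ν₂) in
/-- A nonzero complex measure on `(Y₁ × Y₂) × (X₁ × X₂)` has a nonzero slice over a rectangle of
finite measure in `Y₂ × X₂`. -/
theorem exists_sliceMeasure_fst_ne_zero {σ : ComplexMeasure ((Y₁ × Y₂) × (X₁ × X₂))}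
    (hσ : σ ≠ 0) :
    ∃ A B, MeasurableSet A ∧ MeasurableSet B ∧ μ₂ A ≠ ∞ ∧ ν₂ B ≠ ∞ ∧
      sliceMeasure σ (Prod.fst : X₁ × X₂ → X₁) (Prod.fst : Y₁ × Y₂ → Y₁) (univ ×ˢ A)
        (univ ×ˢ B) ≠ 0 := by
  by_contra! hall
  refine map_measurableEquiv_ne_zero (rhoEquiv Y₁ Y₂ X₁ X₂) hσ ?_
  have hφ : Measurable (Prod.map Prod.fst Prod.fst : (Y₁ × Y₂) × (X₁ × X₂) → Y₁ × X₁) :=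
    measurable_fst.prodMap measurable_fst
  have hψ : Measurable (Prod.map Prod.snd Prod.snd : (Y₁ × Y₂) × (X₁ × X₂) → Y₂ × X₂) :=
    measurable_snd.prodMap measurable_snd
  have hrect : ∀ E F, MeasurableSet E → MeasurableSet F →
      (σ.map (rhoEquiv Y₁ Y₂ X₁ X₂)) (E ×ˢ F) = 0 := fun E F hE hF => by
    -- For fixed `E`, the value of this measure on `B ×ˢ A` is the value at `E` of the slice over
    -- `A` and `B`, which is zero by assumption.
    have hτ : (σ.restrict (Prod.map Prod.fst Prod.fst ⁻¹' E)).map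
        (Prod.map Prod.snd Prod.snd : (Y₁ × Y₂) × (X₁ × X₂) → Y₂ × X₂) = 0 := by
      refine complexMeasure_eq_zero_of_forall_rectangle μ₂ ν₂ fun A B hA hB hA' hB' => ?_
      have h₀ := congrArg (fun τ : ComplexMeasure (Y₁ × X₁) => τ E) (hall A B hA hB hA' hB')
      have hBA := (MeasurableSet.univ.prod hB : MeasurableSet ((univ : Set Y₁) ×ˢ B)).prod
        (MeasurableSet.univ.prod hA : MeasurableSet ((univ : Set X₁) ×ˢ A))
      simp only [sliceMeasure] at h₀
      rw [VectorMeasure.map_apply _ hφ hE, VectorMeasure.restrict_apply _ hBA (hφ hE)] at h₀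
      rw [VectorMeasure.map_apply _ hψ (hB.prod hA),
        VectorMeasure.restrict_apply _ (hφ hE) (hψ (hB.prod hA)), inter_comm]
      refine Eq.trans (congrArg σ ?_) h₀
      ext p
      simp [Set.mem_prod]
    have h₀ := congrArg (fun τ : ComplexMeasure (Y₂ × X₂) => τ F) hτ
    rw [VectorMeasure.map_apply _ hψ hF, VectorMeasure.restrict_apply _ (hφ hE) (hψ hF)] at h₀
    rw [VectorMeasure.map_apply _ (rhoEquiv Y₁ Y₂ X₁ X₂).measurable (hE.prod hF)]
    refine Eq.trans (congrArg σ ?_) h₀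
    ext p
    simp only [rhoEquiv_apply, mem_preimage, mem_prod, mem_inter_iff, Prod.map]
    exact and_comm
  refine VectorMeasure.ext_of_generateFrom _ ?_ generateFrom_prod.symm isPiSystem_prod ?_
  · rintro _ ⟨E, hE, F, hF, rfl⟩
    rw [hrect E F hE hF]; rfl
  · rw [← univ_prod_univ, hrect _ _ .univ .univ]; rfl

theorem map_fst_restrict_univ_prod_le {A : Set X₂} {C : ℝ≥0}
    (hC : μ₂ A ≤ C) : (((μ₁.prod μ₂).restrict (univ ×ˢ A)).map Prod.fst) ≤ C • μ₁ := by
  rw [← Measure.prod_restrict, Measure.restrict_univ, Measure.map_fst_prod,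
    Measure.restrict_apply_univ]
  exact fun s => by simpa using mul_le_mul_left hC (μ₁ s)

theorem IsOperatorM0Set.fst_of_rho_image {κ₁ : Set (X₁ × Y₁)} {κ₂ : Set (X₂ × Y₂)}
    (hκ₁ : IsOmegaClosed μ₁ ν₁ κ₁)
    (h : IsOperatorM0Set (μ₁.prod μ₂) (ν₁.prod ν₂) (rho '' (κ₁ ×ˢ κ₂))) :
    IsOperatorM0Set μ₁ ν₁ κ₁ := by
  obtain ⟨-, σ, hσ, hσ0, T, hT, hTc⟩ := h
  obtain ⟨A, B, hA, hB, hA', hB', hne⟩ := exists_sliceMeasure_fst_ne_zero μ₂ ν₂ hσ0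
  -- One positive constant has to serve for both marginals: the sum bounds both measures and the `1`
  -- makes it positive.
  have hCA : μ₂ A ≤ ((μ₂ A).toNNReal + (ν₂ B).toNNReal + 1 : ℝ≥0) := by
    conv_lhs => rw [← ENNReal.coe_toNNReal hA']
    gcongr
    rw [add_assoc]
    exact le_self_add
  have hCB : ν₂ B ≤ ((μ₂ A).toNNReal + (ν₂ B).toNNReal + 1 : ℝ≥0) := by
    conv_lhs => rw [← ENNReal.coe_toNNReal hB']
    gcongr
    rw [add_right_comm]
    exact le_add_self
  refine isOperatorM0Set_of_sliceMeasure_ne_zero hσ hT hTc measurable_fst measurable_fst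
    (MeasurableSet.univ.prod hA) (MeasurableSet.univ.prod hB) (by positivity)
    (map_fst_restrict_univ_prod_le hCA) (map_fst_restrict_univ_prod_le hCB) hκ₁ ?_ hne
  intro x _ y _ hxy
  rw [rho_image_prod] at hxy
  exact hxy.1

theorem IsOperatorM0Set.swap_rho_image {κ₁ : Set (X₁ × Y₁)} {κ₂ : Set (X₂ × Y₂)}
    (hκ₁ : IsOmegaClosed μ₁ ν₁ κ₁) (hκ₂ : IsOmegaClosed μ₂ ν₂ κ₂)
    (h : IsOperatorM0Set (μ₁.prod μ₂) (ν₁.prod ν₂) (rho '' (κ₁ ×ˢ κ₂))) :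
    IsOperatorM0Set (μ₂.prod μ₁) (ν₂.prod ν₁) (rho '' (κ₂ ×ˢ κ₁)) := by
  obtain ⟨-, σ, hσ, hσ0, T, hT, hTc⟩ := h
  refine isOperatorM0Set_of_sliceMeasure_ne_zero (u := Prod.swap) (v := Prod.swap) (A := univ)
    (B := univ) (C := 1) hσ hT hTc measurable_swap measurable_swap .univ .univ one_pos
    ?_ ?_ (hκ₂.rho_image hκ₁) ?_ ?_
  · rw [Measure.restrict_univ, Measure.prod_swap, one_smul]
  · rw [Measure.restrict_univ, Measure.prod_swap, one_smul]
  · intro x _ y _ hxy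
    rw [rho_image_prod] at hxy ⊢
    exact ⟨hxy.2, hxy.1⟩
  · rw [sliceMeasure, univ_prod_univ, VectorMeasure.restrict_univ]
    exact map_measurableEquiv_ne_zero
      (MeasurableEquiv.prodCongr (MeasurableEquiv.prodComm (α := Y₁) (β := Y₂))
        (MeasurableEquiv.prodComm (α := X₁) (β := X₂))) hσ0

end Forward

/-! ### From the factors to the product set -/

section Backward

variable {X₁ X₂ Y₁ Y₂ : Type*} [MeasurableSpace X₁] [MeasurableSpace X₂] [MeasurableSpace Y₁]
  [MeasurableSpace Y₂] {μ₁ : Measure X₁} {μ₂ : Measure X₂} {ν₁ : Measure Y₁} {ν₂ : Measure Y₂}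

/-- The product of two complex measures, rearranged to a measure on
`(Y₁ × Y₂) × (X₁ × X₂)`. -/
def rhoProd (σ₁ : ComplexMeasure (Y₁ × X₁)) (σ₂ : ComplexMeasure (Y₂ × X₂)) :
    ComplexMeasure ((Y₁ × Y₂) × (X₁ × X₂)) :=
  (σ₁.prod σ₂ (ContinuousLinearMap.mul ℝ ℂ)).map (rhoEquiv Y₁ X₁ Y₂ X₂)

variable {σ₁ : ComplexMeasure (Y₁ × X₁)} {σ₂ : ComplexMeasure (Y₂ × X₂)}

theorem variation_rhoProd_le [IsFiniteMeasure σ₁.variation] [IsFiniteMeasure σ₂.variation] :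
    (rhoProd σ₁ σ₂).variation ≤
      (σ₁.variation.prod σ₂.variation).map (rhoEquiv Y₁ X₁ Y₂ X₂) := by
  refine VectorMeasure.variation_map_le.trans (Measure.map_mono ?_ (MeasurableEquiv.measurable _))
  refine VectorMeasure.variation_prod_le.trans ?_
  have h : ‖ContinuousLinearMap.mul ℝ ℂ‖ₑ ≤ 1 := by
    rw [← ofReal_norm]
    exact ENNReal.ofReal_le_one.2 (ContinuousLinearMap.opNorm_mul_le ℝ ℂ)
  intro s
  simp

theorem rhoProd_rectangle [IsFiniteMeasure σ₁.variation] {A₁ : Set X₁} {A₂ : Set X₂}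
    {B₁ : Set Y₁} {B₂ : Set Y₂} (hA₁ : MeasurableSet A₁) (hA₂ : MeasurableSet A₂)
    (hB₁ : MeasurableSet B₁) (hB₂ : MeasurableSet B₂) :
    rhoProd σ₁ σ₂ ((B₁ ×ˢ B₂) ×ˢ (A₁ ×ˢ A₂)) = σ₁ (B₁ ×ˢ A₁) * σ₂ (B₂ ×ˢ A₂) := by
  rw [rhoProd, VectorMeasure.map_apply _ (MeasurableEquiv.measurable _)
    ((hB₁.prod hB₂).prod (hA₁.prod hA₂))]
  have : rhoEquiv Y₁ X₁ Y₂ X₂ ⁻¹' ((B₁ ×ˢ B₂) ×ˢ (A₁ ×ˢ A₂)) = (B₁ ×ˢ A₁) ×ˢ (B₂ ×ˢ A₂) := by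
    ext p
    simp only [rhoEquiv_apply, mem_preimage, mem_prod]
    tauto
  rw [this, VectorMeasure.prod_apply]
  rfl

theorem rhoProd_ne_zero [IsFiniteMeasure σ₁.variation] (h₁ : σ₁ ≠ 0) (h₂ : σ₂ ≠ 0) :
    rhoProd σ₁ σ₂ ≠ 0 := by
  refine map_measurableEquiv_ne_zero _ fun h => ?_
  obtain ⟨s, hs⟩ : ∃ s, σ₁ s ≠ 0 := by
    by_contra! hall
    exact h₁ (VectorMeasure.ext fun s _ => hall s)
  obtain ⟨t, ht⟩ : ∃ t, σ₂ t ≠ 0 := by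
    by_contra! hall
    exact h₂ (VectorMeasure.ext fun t _ => hall t)
  have := VectorMeasure.prod_apply (μ := σ₁) (ν := σ₂) (B := ContinuousLinearMap.mul ℝ ℂ)
    (s := s) (t := t)
  rw [h] at this
  exact mul_ne_zero hs ht this.symm

variable [SigmaFinite μ₁] [SigmaFinite μ₂] [SigmaFinite ν₁] [SigmaFinite ν₂]

theorem prod_le_smul_prod {X₁ X₂ : Type*} [MeasurableSpace X₁] [MeasurableSpace X₂]
    {μ₁ : Measure X₁} {μ₂ : Measure X₂} [SigmaFinite μ₁] [SigmaFinite μ₂] {m₁ : Measure X₁}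
    {m₂ : Measure X₂} [SFinite m₂] {c₁ c₂ : ℝ≥0} (h₁ : m₁ ≤ c₁ • μ₁) (h₂ : m₂ ≤ c₂ • μ₂) :
    m₁.prod m₂ ≤ (c₁ * c₂) • μ₁.prod μ₂ := by
  refine (Measure.prod_mono h₁ h₂).trans (le_of_eq ?_)
  rw [Measure.prod_smul_left, Measure.prod_smul_right, smul_smul]

theorem IsArvesonMeasure.rhoProd (h₁ : IsArvesonMeasure ν₁ μ₁ σ₁)
    (h₂ : IsArvesonMeasure ν₂ μ₂ σ₂) :
    IsArvesonMeasure (ν₁.prod ν₂) (μ₁.prod μ₂) (rhoProd σ₁ σ₂) := by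
  obtain ⟨hf₁, c₁, hc₁, hν₁, hμ₁⟩ := h₁
  obtain ⟨hf₂, c₂, hc₂, hν₂, hμ₂⟩ := h₂
  refine ⟨isFiniteMeasure_of_le _ variation_rhoProd_le, c₁ * c₂, mul_pos hc₁ hc₂, ?_, ?_⟩
  · refine (Measure.map_mono variation_rhoProd_le measurable_fst).trans ?_
    rw [Measure.map_map measurable_fst (MeasurableEquiv.measurable _)]
    change (σ₁.variation.prod σ₂.variation).map (Prod.map Prod.fst Prod.fst) ≤ _
    rw [← Measure.map_prod_map _ _ measurable_fst measurable_fst]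
    exact prod_le_smul_prod hν₁ hν₂
  · refine (Measure.map_mono variation_rhoProd_le measurable_snd).trans ?_
    rw [Measure.map_map measurable_snd (MeasurableEquiv.measurable _)]
    change (σ₁.variation.prod σ₂.variation).map (Prod.map Prod.snd Prod.snd) ≤ _
    rw [← Measure.map_prod_map _ _ measurable_snd measurable_snd]
    exact prod_le_smul_prod hμ₁ hμ₂

theorem variation_rhoProd_compl_eq_zero [IsFiniteMeasure σ₁.variation]
    [IsFiniteMeasure σ₂.variation] {κ₁ : Set (X₁ × Y₁)} {κ₂ : Set (X₂ × Y₂)}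
    (h₁ : σ₁.variation (hat κ₁)ᶜ = 0) (h₂ : σ₂.variation (hat κ₂)ᶜ = 0) :
    (rhoProd σ₁ σ₂).variation (hat (rho '' (κ₁ ×ˢ κ₂)))ᶜ = 0 := by
  refine Measure.absolutelyContinuous_of_le variation_rhoProd_le ?_
  -- For a measurable equivalence this formula also holds on non-measurable sets, as is needed here.
  rw [MeasurableEquiv.map_apply, rho_image_prod]
  refine measure_mono_null (t := (hat κ₁)ᶜ ×ˢ univ ∪ univ ×ˢ (hat κ₂)ᶜ) ?_ ?_
  · intro p hp
    by_contra hnot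
    simp only [mem_union, mem_prod, mem_univ, and_true, true_and, not_or, notMem_compl_iff] at hnot
    exact hp hnot
  · simp [measure_union_null_iff, Measure.prod_prod, h₁, h₂]

/-- The pseudo-integral operator of a product of Arveson measures is the tensor product of the
pseudo-integral operators. -/
theorem IsPseudoIntegral.rhoProd (h₁ : IsArvesonMeasure ν₁ μ₁ σ₁)
    (h₂ : IsArvesonMeasure ν₂ μ₂ σ₂) {T₁ : Lp ℂ 2 μ₁ →L[ℂ] Lp ℂ 2 ν₁}
    {T₂ : Lp ℂ 2 μ₂ →L[ℂ] Lp ℂ 2 ν₂} (hT₁ : IsPseudoIntegral μ₁ ν₁ σ₁ T₁)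
    (hT₂ : IsPseudoIntegral μ₂ ν₂ σ₂ T₂) :
    IsPseudoIntegral (μ₁.prod μ₂) (ν₁.prod ν₂) (rhoProd σ₁ σ₂)
      (tensorExtend (tensorL2 μ₁ μ₂) (tensorL2 ν₁ ν₂) T₁ T₂) := by
  have hσ := h₁.rhoProd h₂
  have := h₁.1
  -- Since some bounded operator represents the product measure, it suffices to compare it with the
  -- tensor product on indicators of rectangles, whose span is dense.
  obtain ⟨T, hT⟩ := hσ.exists_isPseudoIntegral
  suffices T = tensorExtend (tensorL2 μ₁ μ₂) (tensorL2 ν₁ ν₂) T₁ T₂ by rwa [← this]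
  refine ContinuousLinearMap.ext_on (dense_span_rectangleIndicators μ₁ μ₂) ?_
  rintro _ ⟨A₁, A₂, hA₁, hA₂, hA₁', hA₂', rfl⟩
  refine (dense_span_rectangleIndicators ν₁ ν₂).eq_of_inner_right ℂ ?_
  intro g hg
  induction hg using Submodule.span_induction with
  | zero => simp
  | add x y _ _ hx hy => rw [inner_add_left, inner_add_left, hx, hy]
  | smul c x _ hx => rw [inner_smul_left, inner_smul_left, hx]
  | mem g hg =>
    obtain ⟨B₁, B₂, hB₁, hB₂, hB₁', hB₂', rfl⟩ := hg
    have hA : μ₁.prod μ₂ (A₁ ×ˢ A₂) ≠ ∞ := by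
      rw [Measure.prod_prod]; exact ENNReal.mul_ne_top hA₁' hA₂'
    have hB : ν₁.prod ν₂ (B₁ ×ˢ B₂) ≠ ∞ := by
      rw [Measure.prod_prod]; exact ENNReal.mul_ne_top hB₁' hB₂'
    rw [← tensorL2_tmul μ₁ μ₂, tensorExtend_apply (denseRange_tensorL2 μ₁ μ₂),
      TensorProduct.mapL_tmul, tensorL2_tmul, tensorL2_tmul, inner_mulProdL2,
      hT₁.inner_indicatorConstLp h₁ hA₁ hB₁, hT₂.inner_indicatorConstLp h₂ hA₂ hB₂,
      mulProdL2_indicatorConstLp μ₁ μ₂ hA₁ hA₂ hA₁' hA₂' hA,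
      mulProdL2_indicatorConstLp ν₁ ν₂ hB₁ hB₂ hB₁' hB₂' hB,
      hT.inner_indicatorConstLp hσ (hA₁.prod hA₂) (hB₁.prod hB₂),
      rhoProd_rectangle hA₁ hA₂ hB₁ hB₂]

theorem IsOperatorM0Set.rho_image {κ₁ : Set (X₁ × Y₁)} {κ₂ : Set (X₂ × Y₂)}
    (h₁ : IsOperatorM0Set μ₁ ν₁ κ₁) (h₂ : IsOperatorM0Set μ₂ ν₂ κ₂) :
    IsOperatorM0Set (μ₁.prod μ₂) (ν₁.prod ν₂) (rho '' (κ₁ ×ˢ κ₂)) := by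
  obtain ⟨hκ₁, σ₁, hσ₁, hne₁, T₁, hT₁, hc₁⟩ := h₁
  obtain ⟨hκ₂, σ₂, hσ₂, hne₂, T₂, hT₂, hc₂⟩ := h₂
  have := hσ₁.1.1
  have := hσ₂.1.1
  exact ⟨hκ₁.rho_image hκ₂, rhoProd σ₁ σ₂, ⟨hσ₁.1.rhoProd hσ₂.1,
    variation_rhoProd_compl_eq_zero hσ₁.2 hσ₂.2⟩, rhoProd_ne_zero hne₁ hne₂, _,
    hT₁.rhoProd hσ₁.1 hσ₂.1 hT₂,
    isCompactOperator_tensorExtend (denseRange_tensorL2 μ₁ μ₂) hc₁ hc₂⟩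

end Backward

/-! ### σ-finiteness and conclusion -/

/-- A separable metrizable locally compact space is σ-compact, and a Radon measure is finite on
compact sets. -/
theorem IsStandardMeasureSpace.sigmaFinite {X : Type*} [MeasurableSpace X] {μ : Measure X}
    (h : IsStandardMeasureSpace μ) : SigmaFinite μ := by
  obtain ⟨_, _, _, _, _⟩ := h
  infer_instance

end OperatorM0

end

theorem theorem3p11 {X₁ X₂ Y₁ Y₂ : Type*} [MeasurableSpace X₁] [MeasurableSpace X₂]
    [MeasurableSpace Y₁] [MeasurableSpace Y₂]
    (μ₁ : Measure X₁) (μ₂ : Measure X₂) (ν₁ : Measure Y₁) (ν₂ : Measure Y₂)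
    (hμ₁ : OperatorM0.IsStandardMeasureSpace μ₁) (hμ₂ : OperatorM0.IsStandardMeasureSpace μ₂)
    (hν₁ : OperatorM0.IsStandardMeasureSpace ν₁) (hν₂ : OperatorM0.IsStandardMeasureSpace ν₂)
    (κ₁ : Set (X₁ × Y₁)) (κ₂ : Set (X₂ × Y₂))
    (hκ₁ : OperatorM0.IsOmegaClosed μ₁ ν₁ κ₁) (hκ₂ : OperatorM0.IsOmegaClosed μ₂ ν₂ κ₂) :
    OperatorM0.IsOperatorM0Set (μ₁.prod μ₂) (ν₁.prod ν₂) (OperatorM0.rho '' (κ₁ ×ˢ κ₂)) ↔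
      OperatorM0.IsOperatorM0Set μ₁ ν₁ κ₁ ∧ OperatorM0.IsOperatorM0Set μ₂ ν₂ κ₂ := by
  have := hμ₁.sigmaFinite
  have := hμ₂.sigmaFinite
  have := hν₁.sigmaFinite
  have := hν₂.sigmaFinite
  exact ⟨fun h => ⟨h.fst_of_rho_image hκ₁, (h.swap_rho_image hκ₁ hκ₂).fst_of_rho_image hκ₂⟩,
    fun h => h.1.rho_image h.2⟩
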